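/- Let $\mathbb N$ be the set of positive integers and let $\mathcal I$ be an analytic $P$-ideal on $\mathbb N$: a nonempty family of subsets of $\mathbb N$, closed under subsets and finite unions, with $\mathbb N\notin\mathcal I$, which is an analytic subset of the Cantor space $2^{\mathbb N}$ and such that for all $A_1,A_2,\ldots\in\mathcal I$ there is $B\in\mathcal I$ with $A_n\setminus B$ finite for every $n$. A sequence $(y_n)$ in a topological space $\mathcal I$-converges to $y$ if $\{n: y_n\notin U\}\in\mathcal I$ for every open $U\ni y$. Let $\mathbb T=\mathbb R/\mathbb Z$ and let $\|x\|$ be the distance of $x$ from the nearest integer. For a sequence of integers $(a_n)$ put $t^{\mathcal I}_{(a_n)}(\mathbb T)=\{x\in\mathbb T: a_nx\ \mathcal I\text{-converges to }0\text{ in }\mathbb T\}$; subgroups of this form are called $\mathcal I$-characterized. A set $X\subseteq\mathbb T$ is an $\mathcal I$-Arbault set if there is a strictly increasing sequence $(a_n)$ of positive integers such that $\|a_nx\|$ $\mathcal I$-converges to $0$ for every $x\in X$; let $\mathcal I\mathbb A$ be the family of all $\mathcal I$-Arbault sets. A basis of a family $\mathcal F$ of sets is a subfamily $\mathcal G\subseteq\mathcal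 F$ such that every member of $\mathcal F$ is contained in a member of $\mathcal G$; it is an $F_{\sigma\delta}$ basis if all its members are $F_{\sigma\delta}$ sets (countable intersections of countable unions of closed sets). **Proposition.** The family of all subgroups $t^{\mathcal I}_{(a_n)}(\mathbb T)$, where $(a_n)$ runs over the strictly increasing sequences of positive integers, is an $F_{\sigma\delta}$ basis of $\mathcal I\mathbb A$. In particular, $\mathcal I\mathbb A$ has an $F_{\sigma\delta}$ basis consisting of $\mathcal I$-characterized subgroups of $\mathbb T$. -/

import Mathlib

namespace IArbault

open Topology

/-- The ideal `I` on the positive integers (a nonempty family of subsets, closed under subsets and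
finite unions: Mathlib's `Order.Ideal (Set ℕ+)`) is a `P`-ideal. -/
def IsPIdeal (I : Order.Ideal (Set ℕ+)) : Prop :=
  ∀ A : ℕ → Set ℕ+, (∀ n, A n ∈ I) → ∃ B ∈ I, ∀ n, (A n \ B).Finite

/-- The ideal `I` is analytic: under the identification of subsets with characteristic functions
it is an analytic subset of the Cantor space `2^ℕ` (product of discrete two-point spaces). -/
def IsAnalyticIdeal (I : Order.Ideal (Set ℕ+)) : Prop :=
  MeasureTheory.AnalyticSet {χ : ℕ+ → Bool | {n | χ n = true} ∈ I}

/-- The sequence `u` is `I`-convergent to `x`. -/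
def IConverges {X : Type*} [TopologicalSpace X] (I : Order.Ideal (Set ℕ+)) (u : ℕ+ → X) (x : X) :
    Prop :=
  ∀ U : Set X, IsOpen U → x ∈ U → {n | u n ∉ U} ∈ I

theorem union_mem {I : Order.Ideal (Set ℕ+)} {A B : Set ℕ+} (hA : A ∈ I) (hB : B ∈ I) :
    A ∪ B ∈ I :=
  Order.Ideal.sup_mem hA hB

theorem IConverges.add {G : Type*} [AddGroup G] [TopologicalSpace G] [IsTopologicalAddGroup G]
    {I : Order.Ideal (Set ℕ+)} {u v : ℕ+ → G} {x y : G} (hu : IConverges I u x)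
    (hv : IConverges I v y) : IConverges I (fun n => u n + v n) (x + y) := by
  intro U hU hxy
  have hW : IsOpen ((fun p : G × G => p.1 + p.2) ⁻¹' U) := hU.preimage continuous_add
  obtain ⟨V, W, hV, hW, hxV, hyW, h⟩ := isOpen_prod_iff.1 hW x y hxy
  refine I.lower ?_ (union_mem (hu V hV hxV) (hv W hW hyW))
  intro n hn
  by_contra hc
  simp only [Set.mem_union, Set.mem_setOf_eq, not_or, not_not] at hc
  exact hn (h (Set.mk_mem_prod hc.1 hc.2))

theorem IConverges.neg {G : Type*} [AddGroup G] [TopologicalSpace G] [IsTopologicalAddGroup G]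
    {I : Order.Ideal (Set ℕ+)} {u : ℕ+ → G} {x : G} (hu : IConverges I u x) :
    IConverges I (fun n => - u n) (-x) := by
  intro U hU hx
  exact hu (Neg.neg ⁻¹' U) (hU.preimage continuous_neg) hx

theorem IConverges.const {X : Type*} [TopologicalSpace X] (I : Order.Ideal (Set ℕ+)) (x : X) :
    IConverges I (fun _ => x) x := by
  intro U _ hx
  obtain ⟨A, hA⟩ := I.nonempty
  exact I.lower (fun n hn => absurd hx hn) hA

/-- The subgroup of the circle group `𝕋 = ℝ/ℤ` that is `I`-characterized by the sequence of
integers `a`: all `x` such that `a n • x` is `I`-convergent to `0` in `𝕋`. -/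
def charSubgroup (I : Order.Ideal (Set ℕ+)) (a : ℕ+ → ℤ) : AddSubgroup UnitAddCircle where
  carrier := {x | IConverges I (fun n => a n • x) 0}
  zero_mem' := by
    simpa using IConverges.const I (0 : UnitAddCircle)
  add_mem' := by
    intro x y hx hy
    simpa [smul_add] using IConverges.add hx hy
  neg_mem' := by
    intro x hx
    simpa [smul_neg] using IConverges.neg hx

/-- The family of all subgroups of the circle that are `I`-characterized by an increasing sequence
of positive integers. -/
def increasingCharFamily (I : Order.Ideal (Set ℕ+)) : Set (Set UnitAddCircle) :=
  {Y | ∃ a : ℕ+ → ℕ+, StrictMono a ∧ Y = charSubgroup I (fun n => ((a n : ℕ) : ℤ))}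

/-- `I`-Arbault sets. The norm of `UnitAddCircle` is the distance to the nearest integer. -/
def IsIArbault (I : Order.Ideal (Set ℕ+)) (X : Set UnitAddCircle) : Prop :=
  ∃ a : ℕ+ → ℕ+, StrictMono a ∧ ∀ x ∈ X, IConverges I (fun n => ‖(a n : ℕ) • x‖) (0 : ℝ)

/-- The family `IA` of all `I`-Arbault sets. -/
def arbaultFamily (I : Order.Ideal (Set ℕ+)) : Set (Set UnitAddCircle) :=
  {X | IsIArbault I X}

/-- `𝒢` is a basis of the family `ℱ` of sets. -/
def IsBasis {X : Type*} (𝒢 ℱ : Set (Set X)) : Prop :=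
  𝒢 ⊆ ℱ ∧ ∀ A ∈ ℱ, ∃ Y ∈ 𝒢, A ⊆ Y

/-- `F_σδ` sets: countable intersections of countable unions of closed sets. -/
def IsFSigmaDelta {X : Type*} [TopologicalSpace X] (Y : Set X) : Prop :=
  ∃ F : ℕ → ℕ → Set X, (∀ i j, IsClosed (F i j)) ∧ Y = ⋂ i, ⋃ j, F i j

/-- `𝒢` is an `F_σδ` basis of the family `ℱ`. -/
def IsFSigmaDeltaBasis {X : Type*} [TopologicalSpace X] (𝒢 ℱ : Set (Set X)) : Prop :=
  IsBasis 𝒢 ℱ ∧ ∀ Y ∈ 𝒢, IsFSigmaDelta Y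

end IArbault

namespace IArbault

/-! The basis property is a change of notation; the content is that an analytic `P`-ideal `I` is
`F_σδ` in a form that pulls back to the circle (`exists_isFinitary_of_isAnalyticIdeal`). Parametrize
`I` by a continuous map on Baire space and prune to a closed set on which every nonempty open set
has image cofinal in `I` modulo finite sets (`exists_isCofinalPoint`). Then `A ∈ I` iff its
singletons lie in `I` and, for each basic ball, finite subsets of some tail of `A` are covered by
values from that ball: cofinality gives one direction, an interleaving of two nested ball sequences
(`exists_diff_union_finite`) the other. Since `{n | ε < ‖a n • x‖}` depends on `x` through open
conditions, hereditary closed families pull back to closed sets. -/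

/-- A set of subsets of `ℕ+` that is hereditary and closed in the Cantor space: membership is
decided by finite subsets. -/
def IsFinitary (K : Set (Set ℕ+)) : Prop :=
  ∀ A : Set ℕ+, A ∈ K ↔ ∀ F : Finset ℕ+, (F : Set ℕ+) ⊆ A → (F : Set ℕ+) ∈ K

/-! ### Pruning the parametrization to cofinal points -/

section Pruning

variable {X : Type*} [TopologicalSpace X]

/-- The image under `f` of every neighbourhood of `x` is cofinal in `I` modulo finite sets. -/
def IsCofinalPoint (I : Order.Ideal (Set ℕ+)) (f : X → Set ℕ+) (x : X) : Prop :=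
  ∀ U : Set X, IsOpen U → x ∈ U → ∀ A ∈ I, ∃ y ∈ U, (A \ f y).Finite

theorem isClosed_setOf_isCofinalPoint (I : Order.Ideal (Set ℕ+)) (f : X → Set ℕ+) :
    IsClosed {x | IsCofinalPoint I f x} := by
  rw [← isOpen_compl_iff, isOpen_iff_forall_mem_open]
  intro x hx
  simp only [Set.mem_compl_iff, Set.mem_ofPred_eq, IsCofinalPoint, not_forall] at hx
  obtain ⟨U, hU, hxU, hbad⟩ := hx
  refine ⟨U, fun y hy hc => ?_, hU, hxU⟩
  obtain ⟨A, hA, h⟩ := hbad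
  exact h (hc U hU hy A hA)

/-- Each bad basic open set has a witness in `I` that none of its points captures. The `P`-property
gives one `B` almost containing these countably many witnesses and `A`; a point capturing `B` avoids
all bad sets. -/
theorem exists_isCofinalPoint [SecondCountableTopology X] {I : Order.Ideal (Set ℕ+)}
    (hP : IsPIdeal I) (f : X → Set ℕ+) {V : Set X}
    (hV : ∀ A ∈ I, ∃ y ∈ V, (A \ f y).Finite) :
    ∀ A ∈ I, ∃ y ∈ V, IsCofinalPoint I f y ∧ (A \ f y).Finite := by
  intro A hA
  let b := TopologicalSpace.countableBasis X
  let bad : Set (Set X) := {U | U ∈ b ∧ ∃ C ∈ I, ∀ y ∈ U, ¬ (C \ f y).Finite}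
  have hbad : bad.Countable :=
    (TopologicalSpace.countable_countableBasis X).mono fun U hU => hU.1
  have := hbad.to_subtype
  choose C hCI hC using fun U : bad => U.2.2
  obtain ⟨g, hg⟩ := exists_surjective_nat (Option bad)
  obtain ⟨B, hB, hBfin⟩ := hP (fun n => (g n).elim A C) (by
    intro n
    cases h : g n with
    | none => exact hA
    | some U => exact hCI U)
  have hAB : (A \ B).Finite := by
    obtain ⟨n, hn⟩ := hg none
    simpa [hn] using hBfin n
  have hCB : ∀ U : bad, (C U \ B).Finite := by
    intro U
    obtain ⟨n, hn⟩ := hg (some U)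
    simpa [hn] using hBfin n
  obtain ⟨y, hy, hBy⟩ := hV B hB
  have trans : ∀ D : Set ℕ+, (D \ B).Finite → (D \ f y).Finite := by
    intro D hD
    refine (hD.union hBy).subset fun n hn => ?_
    by_cases h : n ∈ B
    · exact Or.inr ⟨h, hn.2⟩
    · exact Or.inl ⟨hn.1, h⟩
  refine ⟨y, hy, ?_, trans A hAB⟩
  by_contra hc
  simp only [IsCofinalPoint, not_forall] at hc
  obtain ⟨U, hU, hyU, D, hD, h⟩ := hc
  obtain ⟨W, hW, hyW, hWU⟩ :=
    (TopologicalSpace.isBasis_countableBasis X).exists_subset_of_mem_open hyU hU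
  have hWbad : W ∈ bad := ⟨hW, D, hD, fun z hz hfin => h ⟨z, hWU hz, hfin⟩⟩
  exact hC ⟨W, hWbad⟩ y hyW (trans _ (hCB ⟨W, hWbad⟩))

end Pruning

/-! ### Covering by two values -/

section Covering

variable {X : Type*} [MetricSpace X]

/-- Every finite subset of `A` is contained in some `f y` with `y` in the ball of radius `2⁻ᵏ`
around `x`. -/
def FinitelyCovered (f : X → Set ℕ+) (x : X) (k : ℕ) (A : Set ℕ+) : Prop :=
  ∀ F : Finset ℕ+, (F : Set ℕ+) ⊆ A → ∃ y ∈ Metric.ball x ((1 / 2 : ℝ) ^ k), (F : Set ℕ+) ⊆ f y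

/-- The part of `A` from `N` on. -/
def tail (A : Set ℕ+) (N : ℕ) : Set ℕ+ := {n ∈ A | N ≤ (n : ℕ)}

/-- The block of `A` in `[N, m)` is finite, so one value covers it, and by openness so do all values
on a small ball. -/
theorem exists_refinement {f : X → Set ℕ+} (hf : ∀ n, IsOpen {x | n ∈ f x}) {A : Set ℕ+}
    {x : X} {k N : ℕ} (h : FinitelyCovered f x k (tail A N)) (m : ℕ) :
    ∃ (y : X) (l : ℕ), k < l ∧
      Metric.closedBall y ((1 / 2 : ℝ) ^ l) ⊆ Metric.closedBall x ((1 / 2 : ℝ) ^ k) ∧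
      ∀ z ∈ Metric.closedBall y ((1 / 2 : ℝ) ^ l), ∀ n ∈ A, N ≤ (n : ℕ) → (n : ℕ) < m →
        n ∈ f z := by
  have hfin : {n : ℕ+ | n ∈ A ∧ N ≤ (n : ℕ) ∧ (n : ℕ) < m}.Finite :=
    ((Set.finite_lt_nat m).preimage PNat.coe_injective.injOn).subset fun n hn => hn.2.2
  obtain ⟨y, hy, hFy⟩ := h hfin.toFinset (by
    intro n hn
    simp only [Set.Finite.coe_toFinset, Set.mem_ofPred_eq] at hn
    exact ⟨hn.1, hn.2.1⟩)
  have hopen : IsOpen (Metric.ball x ((1 / 2 : ℝ) ^ k) ∩ ⋂ n ∈ hfin.toFinset, {z | n ∈ f z}) :=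
    Metric.isOpen_ball.inter (isOpen_biInter_finset fun n _ => hf n)
  obtain ⟨δ, hδ, hball⟩ := Metric.isOpen_iff.1 hopen y
    ⟨hy, Set.mem_iInter₂.2 fun n hn => hFy hn⟩
  obtain ⟨l, hl⟩ := exists_pow_lt_of_lt_one hδ (by norm_num : (1 / 2 : ℝ) < 1)
  have hle : (1 / 2 : ℝ) ^ (max l (k + 1)) ≤ (1 / 2 : ℝ) ^ l :=
    pow_le_pow_of_le_one (by norm_num) (by norm_num) (le_max_left _ _)
  have hsub := (Metric.closedBall_subset_ball (x := y) (hle.trans_lt hl)).trans hball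
  refine ⟨y, max l (k + 1), by omega, fun z hz => Metric.ball_subset_closedBall (hsub hz).1, ?_⟩
  intro z hz n hn h1 h2
  exact Set.mem_iInter₂.1 (hsub hz).2 n (hfin.mem_toFinset.2 ⟨hn, h1, h2⟩)

theorem exists_mem_closedBalls [CompleteSpace X] (p : ℕ → X × ℕ)
    (hlt : ∀ k, (p k).2 < (p (k + 1)).2)
    (hsub : ∀ k, Metric.closedBall (p (k + 1)).1 ((1 / 2 : ℝ) ^ (p (k + 1)).2) ⊆
      Metric.closedBall (p k).1 ((1 / 2 : ℝ) ^ (p k).2)) :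
    ∃ z, ∀ k, z ∈ Metric.closedBall (p k).1 ((1 / 2 : ℝ) ^ (p k).2) := by
  have hmono : StrictMono fun k => (p k).2 := strictMono_nat_of_lt_succ hlt
  have hanti : Antitone fun k => Metric.closedBall (p k).1 ((1 / 2 : ℝ) ^ (p k).2) :=
    antitone_nat_of_succ_le hsub
  have hmem : ∀ k j, k ≤ j → (p j).1 ∈ Metric.closedBall (p k).1 ((1 / 2 : ℝ) ^ (p k).2) :=
    fun k j hkj => hanti hkj (Metric.mem_closedBall_self (by positivity))
  have hcauchy : CauchySeq fun k => (p k).1 := by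
    refine cauchySeq_of_le_geometric (1 / 2 : ℝ) 1 (by norm_num) fun k => ?_
    have h := hmem k (k + 1) (Nat.le_succ k)
    rw [Metric.mem_closedBall, dist_comm] at h
    rw [one_mul]
    exact h.trans (pow_le_pow_of_le_one (by norm_num) (by norm_num) (hmono.id_le k))
  obtain ⟨z, hz⟩ := cauchySeq_tendsto_of_complete hcauchy
  refine ⟨z, fun k => Metric.isClosed_closedBall.mem_of_tendsto hz ?_⟩
  filter_upwards [Filter.eventually_ge_atTop k] with j hj using hmem k j hj

/-- If some tail of `A` is finitely covered near every point at every scale, then `A` is contained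
in the union of two values of `f`, up to a finite set. -/
theorem exists_diff_union_finite [CompleteSpace X] [Nonempty X] {f : X → Set ℕ+}
    (hf : ∀ n, IsOpen {x | n ∈ f x}) {A : Set ℕ+}
    (hA : ∀ x k, ∃ N, FinitelyCovered f x k (tail A N)) :
    ∃ y z, (A \ (f y ∪ f z)).Finite := by
  have hA' : ∀ p : X × ℕ, ∃ N, p.2 ≤ N ∧ FinitelyCovered f p.1 p.2 (tail A N) := by
    rintro ⟨x, k⟩
    obtain ⟨N, hN⟩ := hA x k
    exact ⟨max N k, le_max_right _ _, fun F hF => hN F fun n hn =>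
      ⟨(hF hn).1, (le_max_left _ _).trans (hF hn).2⟩⟩
  choose N hN hcov using hA'
  have hstep : ∀ (p : X × ℕ) (m : ℕ), ∃ q : X × ℕ, p.2 < q.2 ∧
      Metric.closedBall q.1 ((1 / 2 : ℝ) ^ q.2) ⊆ Metric.closedBall p.1 ((1 / 2 : ℝ) ^ p.2) ∧
      ∀ z ∈ Metric.closedBall q.1 ((1 / 2 : ℝ) ^ q.2), ∀ n ∈ A, N p ≤ (n : ℕ) → (n : ℕ) < m →
        n ∈ f z := by
    intro p m
    obtain ⟨y, l, h⟩ := exists_refinement hf (hcov p) m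
    exact ⟨(y, l), h⟩
  choose step hlt hsub hmem using hstep
  let x₀ : X := Classical.arbitrary X
  -- A new ball imposes a new threshold `N`, which may leave a gap in the covering; each sequence
  -- refines up to the other's current threshold, so the two fill each other's gaps.
  let r : ℕ → (X × ℕ) × (X × ℕ) := fun k => Nat.rec ((x₀, 0), (x₀, 0))
    (fun _ s => (step s.1 (N s.2), step s.2 (N (step s.1 (N s.2))))) k
  obtain ⟨y, hy⟩ := exists_mem_closedBalls (fun k => (r k).1) (fun k => hlt _ _)
    (fun k => hsub _ _)
  obtain ⟨z, hz⟩ := exists_mem_closedBalls (fun k => (r k).2) (fun k => hlt _ _)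
    (fun k => hsub _ _)
  have hgrow : ∀ k, k ≤ N (r k).1 := fun k =>
    ((strictMono_nat_of_lt_succ (f := fun k => (r k).1.2) fun k => hlt _ _).id_le k).trans (hN _)
  refine ⟨y, z, ((Set.finite_lt_nat (N (r 0).1)).preimage PNat.coe_injective.injOn).subset ?_⟩
  rintro n ⟨hnA, hn⟩
  by_contra hc
  have hc : N (r 0).1 ≤ (n : ℕ) := not_lt.1 hc
  have hex : ∃ k, (n : ℕ) < N (r (k + 1)).1 := ⟨n, (Nat.lt_succ_self _).trans_le (hgrow _)⟩
  obtain ⟨k, hk, hk'⟩ : ∃ k, N (r k).1 ≤ (n : ℕ) ∧ (n : ℕ) < N (r (k + 1)).1 := by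
    classical
    refine ⟨Nat.find hex, ?_, Nat.find_spec hex⟩
    rcases h : Nat.find hex with _ | j
    · exact hc
    · exact not_lt.1 (Nat.find_min hex (m := j) (by omega))
  rcases lt_or_ge (n : ℕ) (N (r k).2) with h | h
  · exact hn (Or.inl (hmem _ _ y (hy (k + 1)) n hnA hk h))
  · exact hn (Or.inr (hmem _ _ z (hz (k + 1)) n hnA h hk'))

end Covering

/-! ### The `F_σδ` description of the ideal -/

theorem mem_of_finite {I : Order.Ideal (Set ℕ+)} {F : Set ℕ+} (hF : F.Finite)
    (h : ∀ n ∈ F, {n} ∈ I) : F ∈ I := by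
  induction F, hF using Set.Finite.induction_on with
  | empty => exact Order.Ideal.bot_mem I
  | @insert n S _ _ ih =>
    rw [Set.insert_eq]
    exact union_mem (h n (Set.mem_insert _ _)) (ih fun m hm => h m (Set.mem_insert_of_mem _ hm))

/-- An analytic `P`-ideal is a countable intersection of countable unions of closed hereditary
families. -/
theorem exists_isFinitary_of_isAnalyticIdeal {I : Order.Ideal (Set ℕ+)}
    (hanalytic : IsAnalyticIdeal I) (hP : IsPIdeal I) :
    ∃ K : ℕ × ℕ → ℕ → Set (Set ℕ+), (∀ i j, IsFinitary (K i j)) ∧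
      ∀ A, A ∈ I ↔ ∀ i, ∃ j, A ∈ K i j := by
  have hbot : (∅ : Set ℕ+) ∈ I := Order.Ideal.bot_mem I
  rw [IsAnalyticIdeal, MeasureTheory.AnalyticSet] at hanalytic
  rcases hanalytic with hempty | ⟨g, hg, hrange⟩
  · have h : (fun _ => false : ℕ+ → Bool) ∈ {χ : ℕ+ → Bool | {n | χ n = true} ∈ I} := by
      simpa using hbot
    rw [hempty] at h
    exact h.elim
  let f₀ : (ℕ → ℕ) → Set ℕ+ := fun x => {n | g x n = true}
  have hf₀I : ∀ x, f₀ x ∈ I := by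
    intro x
    have : g x ∈ Set.range g := ⟨x, rfl⟩
    rw [hrange] at this
    exact this
  have hf₀ : ∀ A ∈ I, ∃ x, f₀ x = A := by
    classical
    intro A hA
    have : (fun n => decide (n ∈ A)) ∈ {χ : ℕ+ → Bool | {n | χ n = true} ∈ I} := by
      simpa using hA
    rw [← hrange] at this
    obtain ⟨x, hx⟩ := this
    refine ⟨x, ?_⟩
    ext n
    simp [f₀, hx]
  let X := {x | IsCofinalPoint I f₀ x}
  have hpol : PolishSpace X := (isClosed_setOf_isCofinalPoint I f₀).polishSpace
  let _ : TopologicalSpace.UpgradedIsCompletelyMetrizableSpace X :=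
    TopologicalSpace.upgradeIsCompletelyMetrizable X
  let f : X → Set ℕ+ := fun x => f₀ x
  have hf : ∀ n, IsOpen {x | n ∈ f x} := fun n =>
    (isOpen_discrete {true}).preimage
      ((continuous_apply n).comp (hg.comp continuous_subtype_val))
  have hX : Nonempty X := by
    obtain ⟨y, -, hy, -⟩ := exists_isCofinalPoint hP f₀ (V := Set.univ) (by
      intro A hA
      obtain ⟨x, rfl⟩ := hf₀ A hA
      exact ⟨x, trivial, by simp⟩) ∅ hbot
    exact ⟨⟨y, hy⟩⟩
  have hcof : ∀ U : Set X, IsOpen U → U.Nonempty → ∀ A ∈ I, ∃ y ∈ U, (A \ f y).Finite := by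
    rintro U hU ⟨x, hx⟩ A hA
    obtain ⟨V, hV, rfl⟩ := isOpen_induced_iff.1 hU
    obtain ⟨y, hyV, hy, hfin⟩ := exists_isCofinalPoint hP f₀ (x.2 V hV hx) A hA
    exact ⟨⟨y, hy⟩, hyV, hfin⟩
  let d := TopologicalSpace.denseSeq X
  -- The singleton clause is needed because `I` need not contain all finite sets.
  refine ⟨fun i N => {A | FinitelyCovered f (d i.1) i.2 (tail A N) ∧ ∀ n ∈ A, {n} ∈ I}, ?_, ?_⟩
  · intro i N A
    constructor
    · rintro ⟨h1, h2⟩ F hF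
      exact ⟨fun G hG => h1 G fun n hn => ⟨hF (hG hn).1, (hG hn).2⟩, fun n hn => h2 n (hF hn)⟩
    · intro h
      refine ⟨fun F hF => ?_, fun n hn => ?_⟩
      · exact (h F fun n hn => (hF hn).1).1 F fun n hn => ⟨hn, (hF hn).2⟩
      · exact (h {n} (by simpa using hn)).2 n (by simp)
  · intro A
    constructor
    · rintro hA ⟨i, k⟩
      obtain ⟨y, hy, hfin⟩ := hcof (Metric.ball (d i) ((1 / 2 : ℝ) ^ k)) Metric.isOpen_ball
        ⟨d i, Metric.mem_ball_self (by positivity)⟩ A hA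
      obtain ⟨N, hN⟩ := (hfin.image fun n : ℕ+ => (n : ℕ)).bddAbove
      refine ⟨N + 1, fun F hF => ⟨y, hy, fun n hn => ?_⟩,
        fun n hn => I.lower (Set.singleton_subset_iff.2 hn) hA⟩
      by_contra hc
      have h1 := hN ⟨n, ⟨(hF hn).1, hc⟩, rfl⟩
      have h2 := (hF hn).2
      simp only at h1
      omega
    · intro h
      have hcov : ∀ x k, ∃ N, FinitelyCovered f x k (tail A N) := by
        intro x k
        obtain ⟨i, hi⟩ := (TopologicalSpace.denseRange_denseSeq X).exists_dist_lt x
          (ε := (1 / 2 : ℝ) ^ (k + 1)) (by positivity)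
        -- Halving the radius keeps the ball about the nearby dense point inside the ball about `x`.
        obtain ⟨N, hN, -⟩ := h (i, k + 1)
        refine ⟨N, fun F hF => ?_⟩
        obtain ⟨y, hy, hFy⟩ := hN F hF
        refine ⟨y, Metric.ball_subset_ball' ?_ hy, hFy⟩
        rw [dist_comm] at hi
        have : (1 / 2 : ℝ) ^ k = (1 / 2) ^ (k + 1) + (1 / 2) ^ (k + 1) := by ring
        rw [this]
        exact add_le_add le_rfl hi.le
      obtain ⟨y, z, hyz⟩ := exists_diff_union_finite hf hcov
      obtain ⟨_, -, hsing⟩ := h (0, 0)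
      refine I.lower ?_ (union_mem (mem_of_finite hyz fun n hn => hsing n hn.1)
        (union_mem (hf₀I y) (hf₀I z)))
      intro n hn
      by_cases hc : n ∈ f y ∪ f z
      · exact Or.inr hc
      · exact Or.inl ⟨hn, hc⟩

/-! ### Transfer to the circle -/

/-- Failure of membership is witnessed by a finite subset of `S x`, which remains a subset of `S y`
for `y` near `x`. -/
theorem isClosed_setOf_mem_of_isFinitary {X : Type*} [TopologicalSpace X] {K : Set (Set ℕ+)}
    (hK : IsFinitary K) {S : X → Set ℕ+} (hS : ∀ n, IsOpen {x | n ∈ S x}) :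
    IsClosed {x | S x ∈ K} := by
  rw [← isOpen_compl_iff, isOpen_iff_forall_mem_open]
  intro x hx
  rw [Set.mem_compl_iff, Set.mem_ofPred_eq, hK] at hx
  push Not at hx
  obtain ⟨F, hF, hFK⟩ := hx
  refine ⟨⋂ n ∈ F, {y | n ∈ S y}, fun y hy hc => ?_, isOpen_biInter_finset fun n _ => hS n,
    Set.mem_iInter₂.2 fun n hn => hF hn⟩
  exact hFK ((hK _).1 hc F fun n hn => Set.mem_iInter₂.1 hy n hn)

theorem iConverges_zero_iff {G : Type*} [SeminormedAddCommGroup G] {I : Order.Ideal (Set ℕ+)}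
    {u : ℕ+ → G} :
    IConverges I u 0 ↔ ∀ m : ℕ, {n | 1 / ((m : ℝ) + 1) < ‖u n‖} ∈ I := by
  constructor
  · intro h m
    refine I.lower ?_ (h (Metric.ball 0 (1 / ((m : ℝ) + 1))) Metric.isOpen_ball
      (Metric.mem_ball_self (by positivity)))
    intro n hn
    simpa using (show 1 / ((m : ℝ) + 1) < ‖u n‖ from hn).le
  · intro h U hU h0
    obtain ⟨ε, hε, hball⟩ := Metric.isOpen_iff.1 hU 0 h0
    obtain ⟨m, hm⟩ := exists_nat_one_div_lt hε
    refine I.lower (fun n hn => ?_) (h m)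
    refine hm.trans_le (not_lt.1 fun hc => hn (hball ?_))
    simpa using hc

theorem iConverges_norm_zero_iff {G : Type*} [SeminormedAddCommGroup G]
    {I : Order.Ideal (Set ℕ+)} {u : ℕ+ → G} :
    IConverges I (fun n => ‖u n‖) (0 : ℝ) ↔ IConverges I u 0 := by
  simp only [iConverges_zero_iff, norm_norm]

theorem isFSigmaDelta_charSubgroup {I : Order.Ideal (Set ℕ+)} (hanalytic : IsAnalyticIdeal I)
    (hP : IsPIdeal I) (a : ℕ+ → ℤ) : IsFSigmaDelta (charSubgroup I a : Set UnitAddCircle) := by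
  obtain ⟨K, hK, hI⟩ := exists_isFinitary_of_isAnalyticIdeal hanalytic hP
  obtain ⟨e, he⟩ := exists_surjective_nat (ℕ × (ℕ × ℕ))
  refine ⟨fun i j => {x | {n | 1 / (((e i).1 : ℝ) + 1) < ‖a n • x‖} ∈ K (e i).2 j}, ?_, ?_⟩
  · intro i j
    refine isClosed_setOf_mem_of_isFinitary (hK _ _) fun n => ?_
    -- The strict inequality in the level sets is what makes this condition open.
    exact isOpen_lt continuous_const (continuous_zsmul (a n)).norm
  · ext x
    have hx : x ∈ (charSubgroup I a : Set UnitAddCircle) ↔ IConverges I (fun n => a n • x) 0 :=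
      Iff.rfl
    rw [hx, iConverges_zero_iff]
    simp only [hI, Set.mem_iInter, Set.mem_iUnion, Set.mem_ofPred_eq]
    constructor
    · intro h i
      exact h (e i).1 (e i).2
    · intro h m i
      obtain ⟨k, hk⟩ := he (m, i)
      simpa [hk] using h k

theorem isBasis_increasingCharFamily (I : Order.Ideal (Set ℕ+)) :
    IsBasis (increasingCharFamily I) (arbaultFamily I) := by
  constructor
  · rintro Y ⟨a, ha, rfl⟩
    refine ⟨a, ha, fun x hx => iConverges_norm_zero_iff.2 ?_⟩
    have hx : IConverges I (fun n => ((a n : ℕ) : ℤ) • x) 0 := hx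
    simpa only [natCast_zsmul] using hx
  · rintro A ⟨a, ha, h⟩
    refine ⟨_, ⟨a, ha, rfl⟩, fun x hx => ?_⟩
    change IConverges I (fun n => ((a n : ℕ) : ℤ) • x) 0
    simpa only [natCast_zsmul] using iConverges_norm_zero_iff.1 (h x hx)

end IArbault

theorem propositionp1 (I : Order.Ideal (Set ℕ+)) (hproper : Set.univ ∉ I)
    (hanalytic : IArbault.IsAnalyticIdeal I) (hP : IArbault.IsPIdeal I) :
    IArbault.IsFSigmaDeltaBasis (IArbault.increasingCharFamily I) (IArbault.arbaultFamily I) ∧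
    ∃ 𝒢 : Set (Set UnitAddCircle),
      IArbault.IsFSigmaDeltaBasis 𝒢 (IArbault.arbaultFamily I) ∧
      ∀ Y ∈ 𝒢, ∃ a : ℕ+ → ℤ, Y = (IArbault.charSubgroup I a : Set UnitAddCircle) := by
  have h : IArbault.IsFSigmaDeltaBasis (IArbault.increasingCharFamily I)
      (IArbault.arbaultFamily I) := by
    refine ⟨IArbault.isBasis_increasingCharFamily I, ?_⟩
    rintro Y ⟨a, -, rfl⟩
    exact IArbault.isFSigmaDelta_charSubgroup hanalytic hP _
  refine ⟨h, _, h, ?_⟩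
  rintro Y ⟨a, -, rfl⟩
  exact ⟨_, rfl⟩
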